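/- Let $K$ be a quadratic field of discriminant $d_K<-4$, with maximal order $\mathcal{O}_K$, and let $\mathcal{O}$ be a (not necessarily maximal) order in $K$. Let $p$ be an odd prime with $p\nmid\operatorname{disc}(\mathcal{O})$, and let $\mathcal{P}$ be a set of primes that do not divide $p\,[\mathcal{O}_K:\mathcal{O}]$. For each integer $n\ge 0$, let $R_n$ denote the order $\mathbf{Z}+p^n\mathcal{O}$, let $\operatorname{cl}(R_n)$ be its ideal class group (invertible fractional $R_n$-ideals modulo principal ones), and let $G_n$ be the subgroup of $\operatorname{cl}(R_n)$ generated by the classes of the invertible ideals $I\subseteq R_n$ whose norm $[R_n:I]$ lies in $\mathcal{P}$. If $G_2=\operatorname{cl}(R_2)$, then $G_n=\operatorname{cl}(R_n)$ for every integer $n\ge 0$. -/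

import Mathlib

open scoped nonZeroDivisors

namespace QuadOrder

/-- A subring `O` of a number field `K` is an order in `K` if it is finitely generated as an
abelian group and spans `K` over `ℚ`. -/
class IsOrder {K : Type*} [Field K] [NumberField K] (O : Subalgebra ℤ K) : Prop where
  finite : Module.Finite ℤ O
  span_eq_top : Submodule.span ℚ (O : Set K) = ⊤

attribute [instance] IsOrder.finite

/-- The discriminant of an order: the determinant of the trace form on a `ℤ`-basis
(the choice of the basis does not matter). -/
noncomputable def disc {K : Type*} [Field K] [NumberField K] (O : Subalgebra ℤ K) [IsOrder O] :
    ℤ :=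
  Algebra.discr ℤ (Module.Free.chooseBasis ℤ O)

/-- The index `[O_K : O]` of `O` in the maximal order, the integral closure of `ℤ` in `K`. -/
noncomputable def index {K : Type*} [Field K] [NumberField K] (O : Subalgebra ℤ K) : ℕ :=
  (Subalgebra.toSubmodule O).toAddSubgroup.relIndex
    (Subalgebra.toSubmodule (integralClosure ℤ K)).toAddSubgroup

/-- The ring `ℤ + N O`. -/
def intAdd {K : Type*} [Field K] (N : ℕ) (O : Subalgebra ℤ K) : Subalgebra ℤ K where
  carrier := {x | ∃ a : ℤ, ∃ y ∈ O, x = (a : K) + (N : K) * y}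
  mul_mem' := by
    rintro _ _ ⟨a, y, hy, rfl⟩ ⟨b, z, hz, rfl⟩
    refine ⟨a * b, algebraMap ℤ K a * z + algebraMap ℤ K b * y + algebraMap ℤ K N * (y * z),
      add_mem (add_mem (mul_mem (O.algebraMap_mem a) hz) (mul_mem (O.algebraMap_mem b) hy))
        (mul_mem (O.algebraMap_mem N) (mul_mem hy hz)), ?_⟩
    simp only [eq_intCast, Int.cast_mul, Int.cast_natCast]
    ring
  add_mem' := by
    rintro _ _ ⟨a, y, hy, rfl⟩ ⟨b, z, hz, rfl⟩
    refine ⟨a + b, y + z, add_mem hy hz, ?_⟩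
    push_cast
    ring
  algebraMap_mem' a := ⟨a, 0, zero_mem O, by simp⟩

/-- The classes in `cl(R)` of the invertible ideals `I` of `R` whose norm `[R : I]` lies in `P`. -/
def normClasses (R : Type*) [CommRing R] [IsDomain R] (P : Set ℕ) : Set (ClassGroup R) :=
  {c | ∃ (I : Ideal R) (J : (FractionalIdeal R⁰ (FractionRing R))ˣ),
    (J : FractionalIdeal R⁰ (FractionRing R)) = (I : FractionalIdeal R⁰ (FractionRing R)) ∧
    Nat.card (R ⧸ I) ∈ P ∧ c = ClassGroup.mk (FractionRing R) J}

end QuadOrder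

namespace QuadOrder

/-! Invertible ideals of all the orders R_n = ℤ + p^n O are viewed as ℤ-lattices in K, so that
extension from R_{n+1} to R_n is multiplication by R_n. The claim becomes: principal ideals and
ideals of norm in P generate all invertible fractional ideals (`idealSubgroup` is ⊤). Norms in P are
prime to p and p R_n ⊆ R_{n+1}, so extension and contraction match the generators at the two levels,
and extension carries one `idealSubgroup` onto the other (`map_idealSubgroup`).

Going down, extension is surjective modulo principal ideals: any ideal can be scaled to be coprime
to p and then contracted (`idealSubgroup_eq_top_of_le`).

Going up is a Frattini-type argument. For m ≥ 1 the kernel of extension from R_{m+1} to R_m consists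
of lattices ℤu + p^{m+1} O with u = 1 + p^m x (`exists_latt_eq_one_add`), and it is killed by p. For
n ≥ 1 and p odd, (1 + p^n x)^p ≡ 1 + p^{n+1} x mod p^{n+2} O, so each kernel element from R_{n+2} to
R_{n+1} is a p-th power Y^p. If the subgroup is everything in level n+1, then Y = Z k with Z in the
subgroup and k in the kernel, whence Y^p = Z^p lies in the subgroup. The condition n ≥ 1 is why the
induction starts at level 2. -/

theorem closure_image_eq_top_iff {G H : Type*} [Group G] [Group H] {f : G →* H}
    {N : Subgroup G} (hf : Function.Surjective f) (hN : f.ker = N) (S : Set G) :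
    Subgroup.closure (f '' S) = ⊤ ↔ N ⊔ Subgroup.closure S = ⊤ := by
  subst hN
  have hmap : Subgroup.closure (f '' S) = (f.ker ⊔ Subgroup.closure S).map f := by
    rw [← MonoidHom.map_closure, Subgroup.map_sup, (Subgroup.map_eq_bot_iff _).2 le_rfl,
      bot_sup_eq]
  rw [hmap]
  constructor
  · intro h
    rw [← Subgroup.comap_map_eq_self (le_sup_left (a := f.ker) (b := Subgroup.closure S)), h,
      Subgroup.comap_top]
  · intro h
    rw [h, Subgroup.map_top_of_surjective _ hf]

/-- Replaces the fraction ring of each order by one common field K, so that ideals of different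
orders can be compared. -/
theorem mem_normClasses_iff {R K : Type*} [CommRing R] [IsDomain R] [Field K] [Algebra R K]
    [IsFractionRing R K] {P : Set ℕ} {c : ClassGroup R} :
    c ∈ normClasses R P ↔ ∃ (I : Ideal R) (U : (FractionalIdeal R⁰ K)ˣ),
      (U : FractionalIdeal R⁰ K) = (I : FractionalIdeal R⁰ K) ∧
      Nat.card (R ⧸ I) ∈ P ∧ c = ClassGroup.mk K U := by
  constructor
  · rintro ⟨I, J, hJ, hI, rfl⟩
    refine ⟨I, Units.map (FractionalIdeal.canonicalEquiv R⁰ (FractionRing R) K) J, ?_, hI,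
      (ClassGroup.mk_canonicalEquiv _ K J).symm⟩
    simp [hJ]
  · rintro ⟨I, U, hU, h, rfl⟩
    refine ⟨I, Units.map (FractionalIdeal.canonicalEquiv R⁰ K (FractionRing R)) U, ?_, h,
      (ClassGroup.mk_canonicalEquiv K (FractionRing R) U).symm⟩
    simp [hU]

/-! ### From class groups to groups of fractional ideals. -/

section ClassGroup

variable {R K : Type*} [CommRing R] [IsDomain R] [Field K] [Algebra R K] [IsFractionRing R K]

theorem mk_surjective :
    Function.Surjective (ClassGroup.mk K : (FractionalIdeal R⁰ K)ˣ →* ClassGroup R) := fun x =>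
  ClassGroup.induction K (fun I => ⟨I, rfl⟩) x

theorem ker_mk : (ClassGroup.mk K : (FractionalIdeal R⁰ K)ˣ →* ClassGroup R).ker =
    (toPrincipalIdeal R K).range := by
  ext U
  rw [MonoidHom.mem_ker, ← (ClassGroup.equiv K).injective.eq_iff]
  simp only [ClassGroup.equiv_mk, FractionalIdeal.canonicalEquiv_self,
    QuotientGroup.mk'_apply, map_one, QuotientGroup.eq_one_iff]
  rfl

theorem normClasses_eq_image (P : Set ℕ) :
    normClasses R P = ClassGroup.mk K '' {U : (FractionalIdeal R⁰ K)ˣ |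
      ∃ I : Ideal R, (U : FractionalIdeal R⁰ K) = I ∧ Nat.card (R ⧸ I) ∈ P} := by
  ext c
  rw [mem_normClasses_iff (K := K)]
  constructor
  · rintro ⟨I, U, hU, hI, rfl⟩
    exact ⟨U, ⟨I, hU, hI⟩, rfl⟩
  · rintro ⟨U, ⟨I, hU, hI⟩, rfl⟩
    exact ⟨I, U, hU, hI, rfl⟩

theorem closure_normClasses_eq_top_iff_of_isFractionRing (P : Set ℕ) :
    Subgroup.closure (normClasses R P) = ⊤ ↔
      (toPrincipalIdeal R K).range ⊔ Subgroup.closure {U : (FractionalIdeal R⁰ K)ˣ |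
        ∃ I : Ideal R, (U : FractionalIdeal R⁰ K) = I ∧ Nat.card (R ⧸ I) ∈ P} = ⊤ := by
  rw [normClasses_eq_image (K := K)]
  exact closure_image_eq_top_iff mk_surjective ker_mk _

end ClassGroup

/-! ### Invertible fractional ideals as lattices in K. -/

section Lattice

variable {K : Type*} [Field K] {A B : Subalgebra ℤ K}

/-- The lattice in `K` underlying an invertible fractional ideal. -/
def latt (U : (FractionalIdeal A⁰ K)ˣ) : Submodule ℤ K :=
  ((U : FractionalIdeal A⁰ K) : Submodule A K).restrictScalars ℤ

theorem latt_injective : Function.Injective (latt : (FractionalIdeal A⁰ K)ˣ → Submodule ℤ K) := by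
  intro U V h
  refine Units.ext (FractionalIdeal.coeToSubmodule_injective ?_)
  exact Submodule.restrictScalars_injective ℤ A K h

theorem latt_mul (U V : (FractionalIdeal A⁰ K)ˣ) : latt (U * V) = latt U * latt V := by
  rw [latt, Units.val_mul, FractionalIdeal.coe_mul]
  rfl

theorem latt_one : latt (1 : (FractionalIdeal A⁰ K)ˣ) = Subalgebra.toSubmodule A := by
  ext x
  simp [latt]

theorem latt_mul_inv (U : (FractionalIdeal A⁰ K)ˣ) :
    latt U * latt U⁻¹ = Subalgebra.toSubmodule A := by
  rw [← latt_mul, mul_inv_cancel, latt_one]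

theorem latt_mul_self (U : (FractionalIdeal A⁰ K)ˣ) :
    latt U * Subalgebra.toSubmodule A = latt U := by
  rw [← latt_one, ← latt_mul, mul_one]

theorem one_le_toSubmodule (A : Subalgebra ℤ K) : 1 ≤ Subalgebra.toSubmodule A := by
  rw [Submodule.one_le]
  exact one_mem A

theorem toSubmodule_mul_self (A : Subalgebra ℤ K) :
    Subalgebra.toSubmodule A * Subalgebra.toSubmodule A = Subalgebra.toSubmodule A := by
  rw [← latt_one, ← latt_mul, mul_one]

theorem toSubmodule_mul_of_le (h : A ≤ B) :
    Subalgebra.toSubmodule A * Subalgebra.toSubmodule B = Subalgebra.toSubmodule B := by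
  apply le_antisymm
  · calc _ ≤ Subalgebra.toSubmodule B * Subalgebra.toSubmodule B := by
          gcongr
      _ = _ := toSubmodule_mul_self B
  · calc _ = 1 * Subalgebra.toSubmodule B := (one_mul _).symm
      _ ≤ _ := by
          gcongr
          exact one_le_toSubmodule A

/-- The `A`-submodule on a lattice that is stable under multiplication by `A`. -/
def stableSubmodule (I : Submodule ℤ K) (h : I * Subalgebra.toSubmodule A = I) :
    Submodule A K where
  __ := I
  smul_mem' a x hx := by
    have : x * (a : K) ∈ I * Subalgebra.toSubmodule A := Submodule.mul_mem_mul hx a.2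
    rw [h] at this
    simpa [Algebra.smul_def, mul_comm] using this

/-- Units among the `A`-submodules of K are the same as units among fractional ideals, so no common
denominator has to be produced. -/
theorem exists_latt_eq [IsFractionRing A K] {I J : Submodule ℤ K}
    (hI : I * Subalgebra.toSubmodule A = I) (hJ : J * Subalgebra.toSubmodule A = J)
    (h : I * J = Subalgebra.toSubmodule A) :
    ∃ U : (FractionalIdeal A⁰ K)ˣ, latt U = I := by
  have key : stableSubmodule I hI * stableSubmodule J hJ = 1 := by
    apply Submodule.restrictScalars_injective ℤ A K
    rw [Submodule.restrictScalars_mul]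
    change I * J = _
    rw [h, ← latt_one, latt, Units.val_one, FractionalIdeal.coe_one]
  exact ⟨FractionalIdeal.unitsMulEquivSubmodule.symm (Units.mkOfMulEqOne _ _ key), rfl⟩

/-- The inverse of UB is U⁻¹B, because AB = B. -/
theorem exists_extend [IsFractionRing B K] (h : A ≤ B) :
    ∃ E : (FractionalIdeal A⁰ K)ˣ →* (FractionalIdeal B⁰ K)ˣ,
      ∀ U, latt (E U) = latt U * Subalgebra.toSubmodule B := by
  have hB := toSubmodule_mul_self B
  have (U : (FractionalIdeal A⁰ K)ˣ) :
      ∃ V : (FractionalIdeal B⁰ K)ˣ, latt V = latt U * Subalgebra.toSubmodule B := by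
    refine exists_latt_eq (J := latt U⁻¹ * Subalgebra.toSubmodule B) ?_ ?_ ?_
    · rw [mul_assoc, hB]
    · rw [mul_assoc, hB]
    · rw [mul_mul_mul_comm, hB, latt_mul_inv, toSubmodule_mul_of_le h]
  choose E hE using this
  refine ⟨MonoidHom.mk' E fun U V => latt_injective ?_, hE⟩
  rw [latt_mul, hE, hE, hE, latt_mul, mul_mul_mul_comm, hB]

theorem latt_toPrincipalIdeal [IsFractionRing A K] (x : Kˣ) :
    latt (toPrincipalIdeal A K x) = Submodule.span ℤ {(x : K)} * Subalgebra.toSubmodule A := by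
  ext y
  rw [latt, coe_toPrincipalIdeal, FractionalIdeal.coe_spanSingleton,
    Submodule.mem_span_singleton_mul, Submodule.restrictScalars_mem, Submodule.mem_span_singleton]
  constructor
  · rintro ⟨a, rfl⟩
    exact ⟨a, a.2, by simp [Algebra.smul_def, mul_comm]⟩
  · rintro ⟨a, ha, rfl⟩
    exact ⟨⟨a, ha⟩, by simp [Algebra.smul_def, mul_comm]⟩

/-- The invertible integral ideals of `A` whose norm lies in `P`. -/
def normIdeals (A : Subalgebra ℤ K) (P : Set ℕ) : Set (FractionalIdeal A⁰ K)ˣ :=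
  {U | latt U ≤ Subalgebra.toSubmodule A ∧
    (latt U).toAddSubgroup.relIndex (Subalgebra.toSubmodule A).toAddSubgroup ∈ P}

theorem relIndex_latt_of_coe_eq [IsFractionRing A K] {U : (FractionalIdeal A⁰ K)ˣ} {I : Ideal A}
    (h : (U : FractionalIdeal A⁰ K) = I) :
    latt U ≤ Subalgebra.toSubmodule A ∧
      (latt U).toAddSubgroup.relIndex (Subalgebra.toSubmodule A).toAddSubgroup =
        Nat.card (A ⧸ I) := by
  have hmem (x : K) : x ∈ latt U ↔ ∃ a ∈ I, (a : K) = x := by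
    rw [latt, h, Submodule.restrictScalars_mem, FractionalIdeal.mem_coe,
      FractionalIdeal.mem_coeIdeal]
    rfl
  refine ⟨fun x hx => ?_, ?_⟩
  · obtain ⟨a, -, rfl⟩ := (hmem x).1 hx
    exact a.2
  · change ((latt U).toAddSubgroup.addSubgroupOf _).index =
      (Submodule.toAddSubgroup I).index
    congr 1
    ext a
    rw [AddSubgroup.mem_addSubgroupOf]
    change (a : K) ∈ latt U ↔ a ∈ I
    rw [hmem]
    constructor
    · rintro ⟨b, hb, hba⟩
      rwa [← Subtype.ext hba]
    · exact fun ha => ⟨a, ha, rfl⟩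

theorem mem_normIdeals_iff [IsFractionRing A K] {P : Set ℕ} {U : (FractionalIdeal A⁰ K)ˣ} :
    U ∈ normIdeals A P ↔
      ∃ I : Ideal A, (U : FractionalIdeal A⁰ K) = I ∧ Nat.card (A ⧸ I) ∈ P := by
  constructor
  · rintro ⟨h1, h2⟩
    have : (U : FractionalIdeal A⁰ K) ≤ 1 := by
      intro x hx
      rw [FractionalIdeal.mem_one_iff]
      exact ⟨⟨x, h1 hx⟩, rfl⟩
    obtain ⟨I, hI⟩ := FractionalIdeal.le_one_iff_exists_coeIdeal.1 this
    refine ⟨I, hI.symm, ?_⟩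
    rwa [← (relIndex_latt_of_coe_eq hI.symm).2]
  · rintro ⟨I, hI, h⟩
    obtain ⟨h1, h2⟩ := relIndex_latt_of_coe_eq hI
    exact ⟨h1, h2 ▸ h⟩

/-- The subgroup of the group of invertible fractional ideals generated by the principal ones and
by those of norm in `P`. -/
def idealSubgroup (A : Subalgebra ℤ K) [IsFractionRing A K] (P : Set ℕ) :
    Subgroup (FractionalIdeal A⁰ K)ˣ :=
  (toPrincipalIdeal A K).range ⊔ Subgroup.closure (normIdeals A P)

theorem closure_normClasses_eq_top_iff [IsFractionRing A K] (P : Set ℕ) :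
    Subgroup.closure (normClasses A P) = ⊤ ↔ idealSubgroup A P = ⊤ := by
  have h : {U : (FractionalIdeal A⁰ K)ˣ |
      ∃ I : Ideal A, (U : FractionalIdeal A⁰ K) = I ∧ Nat.card (A ⧸ I) ∈ P} = normIdeals A P :=
    Set.ext fun U => mem_normIdeals_iff.symm
  rw [idealSubgroup, ← h]
  exact closure_normClasses_eq_top_iff_of_isFractionRing P

end Lattice

/-! ### Extension and contraction of ideals prime to p. -/

section Contraction

variable {K : Type*} [Field K] {A B : Subalgebra ℤ K}

theorem span_natCast_mul_le (p : ℕ) (I : Submodule ℤ K) : Submodule.span ℤ {(p : K)} * I ≤ I := by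
  intro x hx
  obtain ⟨y, hy, rfl⟩ := Submodule.mem_span_singleton_mul.1 hx
  rw [← nsmul_eq_mul]
  exact nsmul_mem hy p

theorem mul_toSubmodule_of_le {I : Submodule ℤ K} (h : A ≤ B)
    (hI : I * Subalgebra.toSubmodule B = I) : I * Subalgebra.toSubmodule A = I := by
  rw [← hI, mul_assoc, mul_comm (Subalgebra.toSubmodule B), toSubmodule_mul_of_le h]

/-- An invertible integral ideal of `B` coprime to `p` contracts to an invertible ideal of a
subring `A` containing `pB`, whose extension is the given ideal. -/
theorem exists_latt_eq_inf [IsFractionRing A K] (h : A ≤ B) {p : ℕ}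
    (hp : Submodule.span ℤ {(p : K)} * Subalgebra.toSubmodule B ≤ Subalgebra.toSubmodule A)
    {V : (FractionalIdeal B⁰ K)ˣ} (hV : latt V ≤ Subalgebra.toSubmodule B)
    (hcop : latt V ⊔ Submodule.span ℤ {(p : K)} * Subalgebra.toSubmodule B =
      Subalgebra.toSubmodule B) :
    ∃ U : (FractionalIdeal A⁰ K)ˣ, latt U = latt V ⊓ Subalgebra.toSubmodule A ∧
      latt U * Subalgebra.toSubmodule B = latt V := by
  set π := Submodule.span ℤ {(p : K)}
  set a := Subalgebra.toSubmodule A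
  set b := Subalgebra.toSubmodule B
  set I := latt V
  set J := latt V⁻¹
  have hab : a ≤ b := h
  have haa : a * a = a := toSubmodule_mul_self A
  have hIJ : I * J = b := latt_mul_inv V
  have hIb : I * b = I := latt_mul_self V
  have hJb : J * b = J := latt_mul_self V⁻¹
  have hIa : I * a = I := mul_toSubmodule_of_le h hIb
  have hJa : J * a = J := mul_toSubmodule_of_le h hJb
  -- Modular law, from pB ⊆ A and I + pB = B.
  have hsup : I ⊓ a ⊔ π * b = a := by
    rw [sup_comm, ← sup_inf_assoc_of_le I hp, sup_comm, hcop, inf_eq_right]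
    exact hab
  have hext : (I ⊓ a) * b = I := by
    apply le_antisymm
    · calc (I ⊓ a) * b ≤ I * b := by gcongr; exact inf_le_left
        _ = I := hIb
    · calc I = I * (I ⊓ a) ⊔ I * (π * b) := by rw [← Submodule.mul_sup, hsup, hIa]
        _ ≤ b * (I ⊓ a) ⊔ (I ⊓ a) * b := by
            apply sup_le_sup
            · gcongr
            · calc I * (π * b) = π * I * 1 := by rw [mul_left_comm, hIb, mul_one]
                _ ≤ (I ⊓ a) * b := by
                  apply mul_le_mul' _ (one_le_toSubmodule B)
                  apply le_inf (span_natCast_mul_le p I)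
                  exact le_trans (mul_le_mul' le_rfl hV) hp
        _ = _ := by rw [mul_comm, sup_idem]
  have hstable : (I ⊓ a) * a = I ⊓ a := by
    apply le_antisymm
    · apply le_inf
      · calc (I ⊓ a) * a ≤ I * a := by gcongr; exact inf_le_left
          _ = I := hIa
      · calc (I ⊓ a) * a ≤ a * a := by gcongr; exact inf_le_right
          _ = a := haa
    · calc I ⊓ a = (I ⊓ a) * 1 := (mul_one _).symm
        _ ≤ _ := mul_le_mul' le_rfl (one_le_toSubmodule A)
  -- The inverse of I ∩ A is A + pJ: since (I ∩ A)B = I and IJ = B, the product is (I ∩ A) + pB = A.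
  have hstable' : (a ⊔ π * J) * a = a ⊔ π * J := by
    rw [Submodule.sup_mul, haa, mul_assoc, hJa]
  obtain ⟨U, hU⟩ := exists_latt_eq hstable hstable' (by
    rw [Submodule.mul_sup, hstable, mul_left_comm, ← hJb, mul_comm J b, ← mul_assoc _ b J, hext,
      hIJ, hsup])
  exact ⟨U, hU, hU ▸ hext⟩

theorem exists_mul_add_mul_eq_one {p q : ℕ} (hpq : p.Coprime q) :
    ∃ u v : ℤ, (u : K) * p + v * q = 1 := by
  obtain ⟨u, v, h⟩ := (Nat.isCoprime_iff_coprime.2 hpq)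
  exact ⟨u, v, by simpa using congrArg (Int.cast : ℤ → K) h⟩

theorem mem_of_natCast_mul_mem {p q : ℕ} (hpq : p.Coprime q) {I : Submodule ℤ K} {x : K}
    (h1 : (p : K) * x ∈ I) (h2 : (q : K) * x ∈ I) : x ∈ I := by
  obtain ⟨u, v, h⟩ := exists_mul_add_mul_eq_one (K := K) hpq
  have : x = u • ((p : K) * x) + v • ((q : K) * x) := by
    rw [zsmul_eq_mul, zsmul_eq_mul]
    linear_combination (-x) * h
  rw [this]
  exact add_mem (Submodule.smul_mem _ _ h1) (Submodule.smul_mem _ _ h2)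

/-- The index of I ∩ A in A annihilates the quotient, in particular the class of 1; an infinite
index has value 0, which also lies in I. -/
theorem relIndex_mem (I : Submodule ℤ K) :
    ((I.toAddSubgroup.relIndex (Subalgebra.toSubmodule A).toAddSubgroup : ℕ) : K) ∈ I := by
  have h1 : (1 : K) ∈ (Subalgebra.toSubmodule A).toAddSubgroup := one_mem A
  have := AddSubgroup.nsmul_relIndex_mem I.toAddSubgroup h1
  rwa [nsmul_one] at this

/-- Second isomorphism theorem. -/
theorem relIndex_inf_of_sup_eq {I a b : AddSubgroup K} (h : I ⊔ a = b) :
    (I ⊓ a).relIndex a = I.relIndex b := by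
  rw [← h, AddSubgroup.relIndex_sup_left, AddSubgroup.inf_relIndex_right]

theorem relIndex_inf_eq {I a b : Submodule ℤ K}
    (h : I.toAddSubgroup ⊔ a.toAddSubgroup = b.toAddSubgroup) :
    (I ⊓ a).toAddSubgroup.relIndex a.toAddSubgroup =
      I.toAddSubgroup.relIndex b.toAddSubgroup := by
  have hinf : (I ⊓ a).toAddSubgroup = I.toAddSubgroup ⊓ a.toAddSubgroup :=
    AddSubgroup.ext fun x => Iff.rfl
  rw [hinf, relIndex_inf_of_sup_eq h]

theorem toAddSubgroup_sup_toSubmodule (h : A ≤ B) {p q : ℕ} (hpq : p.Coprime q)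
    (hp : Submodule.span ℤ {(p : K)} * Subalgebra.toSubmodule B ≤ Subalgebra.toSubmodule A)
    {I : Submodule ℤ K} (hI : I ≤ Subalgebra.toSubmodule B)
    (hIb : I * Subalgebra.toSubmodule B = I) (hq : (q : K) ∈ I) :
    I.toAddSubgroup ⊔ (Subalgebra.toSubmodule A).toAddSubgroup =
      (Subalgebra.toSubmodule B).toAddSubgroup := by
  rw [← Submodule.sup_toAddSubgroup]
  congr 1
  apply le_antisymm (sup_le hI h)
  intro x hx
  refine mem_of_natCast_mul_mem hpq ?_ ?_
  · exact Submodule.mem_sup_right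
      (hp (Submodule.mul_mem_mul (Submodule.mem_span_singleton_self _) hx))
  · apply Submodule.mem_sup_left
    rw [← hIb]
    exact Submodule.mul_mem_mul hq hx

/-- Extension of ideals of norm prime to `p` preserves the norm. -/
theorem extend_mem_normIdeals (h : A ≤ B) {p : ℕ}
    (hp : Submodule.span ℤ {(p : K)} * Subalgebra.toSubmodule B ≤ Subalgebra.toSubmodule A)
    {P : Set ℕ} (hP : ∀ q ∈ P, p.Coprime q) {U : (FractionalIdeal A⁰ K)ˣ}
    (hU : U ∈ normIdeals A P) {V : (FractionalIdeal B⁰ K)ˣ}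
    (hV : latt V = latt U * Subalgebra.toSubmodule B) : V ∈ normIdeals B P := by
  obtain ⟨hUA, hUP⟩ := hU
  have hq := relIndex_mem (A := A) (latt U)
  have hpq := hP _ hUP
  have hUV : latt U ≤ latt V := by
    calc latt U = latt U * 1 := (mul_one _).symm
      _ ≤ latt U * Subalgebra.toSubmodule B := mul_le_mul' le_rfl (one_le_toSubmodule B)
      _ = latt V := hV.symm
  have hVB : latt V ≤ Subalgebra.toSubmodule B := by
    calc latt V ≤ Subalgebra.toSubmodule A * Subalgebra.toSubmodule B := by rw [hV]; gcongr
      _ = _ := toSubmodule_mul_of_le h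
  -- Contraction undoes extension: for x in UB ∩ A, px lies in U because pB ⊆ A, and qx lies in U
  -- because the norm q does; p and q are coprime.
  have hinf : latt V ⊓ Subalgebra.toSubmodule A = latt U := by
    apply le_antisymm _ (le_inf hUV hUA)
    rintro x ⟨hx, hxA⟩
    refine mem_of_natCast_mul_mem hpq ?_ ?_
    · have : (p : K) * x ∈ Submodule.span ℤ {(p : K)} * latt V :=
        Submodule.mul_mem_mul (Submodule.mem_span_singleton_self _) hx
      rw [hV, mul_left_comm] at this
      rw [← latt_mul_self U]
      exact mul_le_mul' le_rfl hp this
    · have := Submodule.mul_mem_mul hq hxA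
      rwa [latt_mul_self] at this
  refine ⟨hVB, ?_⟩
  rw [← relIndex_inf_eq (toAddSubgroup_sup_toSubmodule h hpq hp hVB (latt_mul_self V) (hUV hq)),
    hinf]
  exact hUP

theorem exists_mem_normIdeals_of_mem [IsFractionRing A K] (h : A ≤ B) {p : ℕ}
    (hp : Submodule.span ℤ {(p : K)} * Subalgebra.toSubmodule B ≤ Subalgebra.toSubmodule A)
    {P : Set ℕ} (hP : ∀ q ∈ P, p.Coprime q) {V : (FractionalIdeal B⁰ K)ˣ}
    (hV : V ∈ normIdeals B P) :
    ∃ U ∈ normIdeals A P, latt U * Subalgebra.toSubmodule B = latt V := by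
  obtain ⟨hVB, hVP⟩ := hV
  have hq := relIndex_mem (A := B) (latt V)
  have hpq := hP _ hVP
  have hcop : latt V ⊔ Submodule.span ℤ {(p : K)} * Subalgebra.toSubmodule B =
      Subalgebra.toSubmodule B := by
    apply le_antisymm (sup_le hVB (span_natCast_mul_le _ _))
    intro x hx
    refine mem_of_natCast_mul_mem hpq ?_ ?_
    · exact Submodule.mem_sup_right
        (Submodule.mul_mem_mul (Submodule.mem_span_singleton_self _) hx)
    · apply Submodule.mem_sup_left
      have := Submodule.mul_mem_mul hq hx
      rwa [latt_mul_self] at this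
  obtain ⟨U, hU, hUV⟩ := exists_latt_eq_inf h hp hVB hcop
  refine ⟨U, ⟨hU ▸ inf_le_right, ?_⟩, hUV⟩
  rw [hU, relIndex_inf_eq (toAddSubgroup_sup_toSubmodule h hpq hp hVB (latt_mul_self V) hq)]
  exact hVP

end Contraction

/-! ### Scaling an invertible ideal to be coprime to a given ideal. -/

theorem finite_setOf_isMaximal_of_finite_quotient {R : Type*} [CommRing R] (c : Ideal R)
    [Finite (R ⧸ c)] : {M : Ideal R | M.IsMaximal ∧ c ≤ M}.Finite := by
  have : Finite (Ideal (R ⧸ c)) := Finite.of_injective _ SetLike.coe_injective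
  refine (Set.finite_range (Ideal.comap (Ideal.Quotient.mk c))).subset ?_
  rintro M ⟨-, hM⟩
  refine ⟨M.map (Ideal.Quotient.mk c), ?_⟩
  rw [Ideal.comap_map_of_surjective _ Ideal.Quotient.mk_surjective, ← RingHom.ker_eq_comap_bot,
    Ideal.mk_ker, sup_eq_left]
  exact hM

theorem finite_quotient_span_natCast {R : Type*} [CommRing R] [Module.Finite ℤ R] {p : ℕ}
    (hp : p ≠ 0) : Finite (R ⧸ Ideal.span {(p : R)}) := by
  have : Module.Finite ℤ (R ⧸ Ideal.span {(p : R)}) :=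
    Module.Finite.of_surjective
      (Ideal.Quotient.mk (Ideal.span {(p : R)})).toAddMonoidHom.toIntLinearMap
      Ideal.Quotient.mk_surjective
  refine Module.finite_of_fg_torsion _ fun {x} => ?_
  refine ⟨⟨(p : ℤ), mem_nonZeroDivisors_of_ne_zero (by exact_mod_cast hp)⟩, ?_⟩
  obtain ⟨y, rfl⟩ := Ideal.Quotient.mk_surjective x
  change (p : ℤ) • Ideal.Quotient.mk (Ideal.span {(p : R)}) y = 0
  rw [zsmul_eq_mul, Int.cast_natCast, ← map_natCast (Ideal.Quotient.mk _), ← map_mul,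
    Ideal.Quotient.eq_zero_iff_mem]
  exact Ideal.mul_mem_right _ _ (Ideal.mem_span_singleton_self _)

/-- An invertible fractional ideal can be scaled to an integral ideal coprime to `c`, if only
finitely many maximal ideals contain `c`. -/
theorem exists_mul_add_eq_one {R K : Type*} [CommRing R] [Field K] [Algebra R K]
    [IsFractionRing R K] {c : Ideal R} (hf : {M : Ideal R | M.IsMaximal ∧ c ≤ M}.Finite)
    {I J : FractionalIdeal R⁰ K} (hIJ : I * J = 1) :
    ∃ v ∈ J, ∃ a ∈ I, ∃ r ∈ c, a * v + algebraMap R K r = 1 := by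
  classical
  have hinj := FaithfulSMul.algebraMap_injective R K
  set s := hf.toFinset
  have hs {M : Ideal R} : M ∈ s ↔ M.IsMaximal ∧ c ≤ M := hf.mem_toFinset
  have hle {a b : K} (ha : a ∈ I) (hb : b ∈ J) : ∃ r, algebraMap R K r = a * b :=
    (FractionalIdeal.mem_one_iff _).1 (hIJ ▸ FractionalIdeal.mul_mem_mul ha hb)
  have h1 : ∀ M ∈ s, ∃ a ∈ I, ∃ b ∈ J, ∀ m ∈ M, algebraMap R K m ≠ a * b := by
    intro M hM
    by_contra! h
    have : I * J ≤ (M : FractionalIdeal R⁰ K) := by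
      rw [FractionalIdeal.mul_le]
      intro a ha b hb
      rw [FractionalIdeal.mem_coeIdeal]
      exact h a ha b hb
    have h1 : (1 : K) ∈ (M : FractionalIdeal R⁰ K) :=
      this (hIJ ▸ FractionalIdeal.one_mem_one R⁰)
    obtain ⟨m, hm, hm1⟩ := (FractionalIdeal.mem_coeIdeal _).1 h1
    rw [← map_one (algebraMap R K)] at hm1
    exact (hs.1 hM).1.ne_top ((Ideal.eq_top_iff_one M).2 (hinj hm1 ▸ hm))
  have h2 : ∀ M ∈ s, ∃ u, (∀ M' ∈ s, M' ≠ M → u ∈ M') ∧ u ∉ M := by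
    intro M hM
    have : IsCoprime M (⨅ M' ∈ s.erase M, M') := by
      rw [Ideal.isCoprime_iff_sup_eq]
      refine Ideal.sup_iInf_eq_top fun M' hM' => ?_
      rw [Finset.mem_erase] at hM'
      exact Ideal.IsMaximal.coprime_of_ne (hs.1 hM).1 (hs.1 hM'.2).1 hM'.1.symm
    obtain ⟨m, hm, u, hu, hmu⟩ := Ideal.isCoprime_iff_exists.1 this
    refine ⟨u, fun M' hM' hne => ?_, fun hu' => ?_⟩
    · simp only [Ideal.mem_iInf, Finset.mem_erase] at hu
      exact hu M' ⟨hne, hM'⟩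
    · exact (hs.1 hM).1.ne_top ((Ideal.eq_top_iff_one M).2 (hmu ▸ add_mem hm hu'))
  choose! a ha b hb hab using h1
  choose! u hu huM using h2
  -- Chinese remainder choice: modulo M, every term of a_M v except a_M b_M u_M vanishes, and that
  -- one is nonzero. Hence Iv lies in no maximal ideal containing c.
  set v := ∑ M ∈ s, u M • b M
  have hv : v ∈ J := Submodule.sum_mem J.val fun M hM => Submodule.smul_mem _ _ (hb M hM)
  refine ⟨v, hv, ?_⟩
  let N : Ideal R :=
    { carrier := {r | ∃ a ∈ I, algebraMap R K r = a * v}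
      zero_mem' := ⟨0, I.val.zero_mem, by simp⟩
      add_mem' := by
        rintro x y ⟨a, ha, hx⟩ ⟨b, hb, hy⟩
        exact ⟨a + b, I.val.add_mem ha hb, by rw [map_add, hx, hy, add_mul]⟩
      smul_mem' := by
        rintro r x ⟨a, ha, hx⟩
        exact ⟨r • a, I.val.smul_mem r ha, by
          rw [smul_eq_mul, map_mul, hx, Algebra.smul_def, mul_assoc]⟩ }
  have htop : N ⊔ c = ⊤ := by
    by_contra h
    obtain ⟨M, hM, hNM⟩ := Ideal.exists_le_maximal _ h
    have hMs : M ∈ s := hs.2 ⟨hM, le_sup_right.trans hNM⟩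
    have hex : ∀ M' ∈ s, ∃ r, algebraMap R K r = a M * b M' := fun M' hM' =>
      hle (ha M hMs) (hb M' hM')
    choose! r hr using hex
    have hsum : ∑ M' ∈ s, u M' * r M' ∈ N := by
      refine ⟨a M, ha M hMs, ?_⟩
      rw [map_sum, Finset.mul_sum]
      refine Finset.sum_congr rfl fun M' hM' => ?_
      rw [map_mul, hr M' hM', Algebra.smul_def]
      ring
    have hsumM := hNM (Ideal.mem_sup_left hsum)
    rw [← s.add_sum_erase _ hMs, Ideal.add_mem_iff_left] at hsumM
    · rcases hM.isPrime.mem_or_mem hsumM with h | h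
      · exact huM M hMs h
      · exact hab M hMs _ h (hr M hMs)
    · refine Ideal.sum_mem _ fun M' hM' => ?_
      rw [Finset.mem_erase] at hM'
      exact Ideal.mul_mem_right _ _ (hu M' hM'.2 M hMs hM'.1.symm)
  have h1 : (1 : R) ∈ N ⊔ c := htop ▸ Submodule.mem_top
  obtain ⟨n, ⟨a, ha, hn⟩, r, hr, h⟩ := Submodule.mem_sup.1 h1
  exact ⟨a, ha, r, hr, by rw [← hn, ← map_add, h, map_one]⟩

/-! ### Passing from an order to a larger one. -/

section Descent

variable {K : Type*} [Field K] {A B : Subalgebra ℤ K}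

theorem toPrincipalIdeal_mem [IsFractionRing A K] (P : Set ℕ) (x : Kˣ) :
    toPrincipalIdeal A K x ∈ idealSubgroup A P :=
  Subgroup.mem_sup_left ⟨x, rfl⟩

theorem extend_toPrincipalIdeal [IsFractionRing A K] [IsFractionRing B K] (h : A ≤ B)
    {E : (FractionalIdeal A⁰ K)ˣ →* (FractionalIdeal B⁰ K)ˣ}
    (hE : ∀ U, latt (E U) = latt U * Subalgebra.toSubmodule B) (x : Kˣ) :
    E (toPrincipalIdeal A K x) = toPrincipalIdeal B K x := by
  apply latt_injective
  rw [hE, latt_toPrincipalIdeal, latt_toPrincipalIdeal, mul_assoc, toSubmodule_mul_of_le h]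

/-- The extension of ideals along `A ≤ B` maps the subgroup for `A` onto the one for `B`. -/
theorem map_idealSubgroup [IsFractionRing A K] [IsFractionRing B K] (h : A ≤ B) {p : ℕ}
    (hp : Submodule.span ℤ {(p : K)} * Subalgebra.toSubmodule B ≤ Subalgebra.toSubmodule A)
    {P : Set ℕ} (hP : ∀ q ∈ P, p.Coprime q)
    {E : (FractionalIdeal A⁰ K)ˣ →* (FractionalIdeal B⁰ K)ˣ}
    (hE : ∀ U, latt (E U) = latt U * Subalgebra.toSubmodule B) :
    (idealSubgroup A P).map E = idealSubgroup B P := by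
  rw [idealSubgroup, idealSubgroup, Subgroup.map_sup, MonoidHom.map_closure]
  congr 2
  · ext V
    constructor
    · rintro ⟨_, ⟨x, rfl⟩, rfl⟩
      exact ⟨x, (extend_toPrincipalIdeal h hE x).symm⟩
    · rintro ⟨x, rfl⟩
      exact ⟨_, ⟨x, rfl⟩, extend_toPrincipalIdeal h hE x⟩
  · ext V
    constructor
    · rintro ⟨U, hU, rfl⟩
      exact extend_mem_normIdeals h hp hP hU (hE U)
    · intro hV
      obtain ⟨U, hU, hUV⟩ := exists_mem_normIdeals_of_mem h hp hP hV
      exact ⟨U, hU, latt_injective ((hE U).trans hUV)⟩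

theorem exists_toPrincipalIdeal_mul_coprime [IsFractionRing B K] [Module.Finite ℤ B] {p : ℕ}
    (hp0 : p ≠ 0) (hpB : ∀ x ∈ B, (p : K) * x ≠ 1) (V : (FractionalIdeal B⁰ K)ˣ) :
    ∃ x : Kˣ, latt (V * toPrincipalIdeal B K x) ≤ Subalgebra.toSubmodule B ∧
      latt (V * toPrincipalIdeal B K x) ⊔
        Submodule.span ℤ {(p : K)} * Subalgebra.toSubmodule B = Subalgebra.toSubmodule B := by
  have := finite_quotient_span_natCast (R := B) hp0
  obtain ⟨v, hv, a, ha, r, hr, h⟩ :=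
    exists_mul_add_eq_one (finite_setOf_isMaximal_of_finite_quotient (Ideal.span {(p : B)}))
      (Units.mul_inv V)
  obtain ⟨t, rfl⟩ := Ideal.mem_span_singleton'.1 hr
  have h' : a * v + p * t = 1 := by
    rw [← h, mul_comm t, map_mul, map_natCast]
    rfl
  -- If v = 0 then p t = 1, but p is not a unit in B.
  have hv0 : v ≠ 0 := by
    rintro rfl
    exact hpB t t.2 (by rw [← h', mul_zero, zero_add])
  have hlatt : latt (V * toPrincipalIdeal B K (Units.mk0 v hv0)) =
      latt V * Submodule.span ℤ {v} := by
    rw [latt_mul, latt_toPrincipalIdeal, mul_left_comm, latt_mul_self, mul_comm]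
    rfl
  have hle : latt V * Submodule.span ℤ {v} ≤ Subalgebra.toSubmodule B := by
    rw [← latt_mul_inv V]
    refine mul_le_mul' le_rfl ?_
    rw [Submodule.span_singleton_le_iff_mem]
    exact hv
  refine ⟨Units.mk0 v hv0, hlatt ▸ hle, ?_⟩
  rw [hlatt]
  apply le_antisymm (sup_le hle (span_natCast_mul_le _ _))
  intro x hx
  have hx' : x = (a * x) * v + p * (t * x) := by linear_combination (-x) * h'
  rw [hx']
  refine add_mem (Submodule.mem_sup_left ?_) (Submodule.mem_sup_right ?_)
  · refine Submodule.mul_mem_mul ?_ (Submodule.mem_span_singleton_self v)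
    rw [← latt_mul_self V]
    exact Submodule.mul_mem_mul ha hx
  · exact Submodule.mul_mem_mul (Submodule.mem_span_singleton_self _)
      (show (t * x : K) ∈ B from mul_mem t.2 hx)

/-- Up to a principal factor every ideal of B is coprime to p, hence extended from its contraction
to A. -/
theorem idealSubgroup_eq_top_of_le [IsFractionRing A K] [IsFractionRing B K] [Module.Finite ℤ B]
    (h : A ≤ B) {p : ℕ} (hp0 : p ≠ 0) (hpB : ∀ x ∈ B, (p : K) * x ≠ 1)
    (hp : Submodule.span ℤ {(p : K)} * Subalgebra.toSubmodule B ≤ Subalgebra.toSubmodule A)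
    {P : Set ℕ} (hP : ∀ q ∈ P, p.Coprime q) (hA : idealSubgroup A P = ⊤) :
    idealSubgroup B P = ⊤ := by
  obtain ⟨E, hE⟩ := exists_extend (A := A) (B := B) h
  rw [eq_top_iff]
  rintro V -
  obtain ⟨x, hx, hcop⟩ := exists_toPrincipalIdeal_mul_coprime hp0 hpB V
  obtain ⟨U, -, hU⟩ := exists_latt_eq_inf h hp hx hcop
  have hEU : E U = V * toPrincipalIdeal B K x := latt_injective ((hE U).trans hU)
  rw [← Subgroup.mul_mem_cancel_right _ (toPrincipalIdeal_mem P x), ← hEU,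
    ← map_idealSubgroup h hp hP hE, hA]
  exact ⟨U, trivial, rfl⟩

end Descent

/-! ### The lattices ℤu + NO and their products. -/

section IntAdd

variable {K : Type*} [Field K] {O : Subalgebra ℤ K}

theorem mem_intAdd {N : ℕ} {x : K} :
    x ∈ intAdd N O ↔ ∃ a : ℤ, ∃ y ∈ O, x = (a : K) + (N : K) * y := Iff.rfl

theorem intAdd_le (N : ℕ) : intAdd N O ≤ O := by
  rintro _ ⟨a, y, hy, rfl⟩
  exact add_mem (intCast_mem O a) (mul_mem (natCast_mem O N) hy)

theorem intAdd_pow_succ_le (p n : ℕ) : intAdd (p ^ (n + 1)) O ≤ intAdd (p ^ n) O := by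
  rintro _ ⟨a, y, hy, rfl⟩
  exact ⟨a, p * y, mul_mem (natCast_mem O p) hy, by push_cast; ring⟩

theorem span_mul_intAdd_le (p n : ℕ) :
    Submodule.span ℤ {(p : K)} * Subalgebra.toSubmodule (intAdd (p ^ n) O) ≤
      Subalgebra.toSubmodule (intAdd (p ^ (n + 1)) O) := by
  intro x hx
  obtain ⟨_, ⟨a, y, hy, rfl⟩, rfl⟩ := Submodule.mem_span_singleton_mul.1 hx
  exact ⟨p * a, y, hy, by push_cast; ring⟩

/-- The lattice `ℤ u + N O`. -/
def intMulAdd (N : ℕ) (O : Subalgebra ℤ K) (u : K) : Submodule ℤ K where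
  carrier := {x | ∃ a : ℤ, ∃ y ∈ O, x = a * u + N * y}
  zero_mem' := ⟨0, 0, zero_mem O, by simp⟩
  add_mem' := by
    rintro _ _ ⟨a, y, hy, rfl⟩ ⟨b, z, hz, rfl⟩
    exact ⟨a + b, y + z, add_mem hy hz, by push_cast; ring⟩
  smul_mem' := by
    rintro c _ ⟨a, y, hy, rfl⟩
    exact ⟨c * a, c • y, O.toSubmodule.smul_mem c hy, by
      simp only [zsmul_eq_mul]; push_cast; ring⟩

theorem mem_intMulAdd {N : ℕ} {u x : K} :
    x ∈ intMulAdd N O u ↔ ∃ a : ℤ, ∃ y ∈ O, x = a * u + N * y := Iff.rfl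

theorem intMulAdd_one (N : ℕ) : intMulAdd N O 1 = Subalgebra.toSubmodule (intAdd N O) := by
  ext x
  simp [mem_intMulAdd, mem_intAdd]

theorem intMulAdd_add (N : ℕ) (u : K) {y : K} (hy : y ∈ O) :
    intMulAdd N O (u + N * y) = intMulAdd N O u := by
  ext x
  constructor
  · rintro ⟨a, z, hz, rfl⟩
    exact ⟨a, a * y + z, add_mem (mul_mem (intCast_mem O a) hy) hz, by ring⟩
  · rintro ⟨a, z, hz, rfl⟩
    exact ⟨a, z - a * y, sub_mem hz (mul_mem (intCast_mem O a) hy), by ring⟩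

/-- `u` is a unit modulo `N O`. -/
def IsUnitMod (N : ℕ) (O : Subalgebra ℤ K) (u : K) : Prop :=
  u ∈ O ∧ ∃ w ∈ O, ∃ y ∈ O, u * w = 1 + N * y

theorem IsUnitMod.mul {N : ℕ} {u v : K} (hu : IsUnitMod N O u) (hv : IsUnitMod N O v) :
    IsUnitMod N O (u * v) := by
  obtain ⟨hu, w, hw, y, hy, h⟩ := hu
  obtain ⟨hv, w', hw', y', hy', h'⟩ := hv
  refine ⟨mul_mem hu hv, w * w', mul_mem hw hw', y + y' + N * (y * y'),
    add_mem (add_mem hy hy') (mul_mem (natCast_mem O N) (mul_mem hy hy')), ?_⟩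
  linear_combination v * w' * h + (1 + N * y) * h'

theorem isUnitMod_one (N : ℕ) : IsUnitMod N O (1 : K) :=
  ⟨one_mem O, 1, one_mem O, 0, zero_mem O, by simp⟩

theorem IsUnitMod.pow {N : ℕ} {u : K} (hu : IsUnitMod N O u) (k : ℕ) : IsUnitMod N O (u ^ k) := by
  induction k with
  | zero => simpa using isUnitMod_one N
  | succ k ih => rw [pow_succ]; exact ih.mul hu

theorem intMulAdd_mul {N : ℕ} {u v : K} (hu : IsUnitMod N O u) (hv : v ∈ O) :
    intMulAdd N O u * intMulAdd N O v = intMulAdd N O (u * v) := by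
  obtain ⟨hu, w, hw, y, hy, h⟩ := hu
  apply le_antisymm
  · rw [Submodule.mul_le]
    rintro _ ⟨a, s, hs, rfl⟩ _ ⟨b, t, ht, rfl⟩
    refine ⟨a * b, a * (u * t) + b * (s * v) + N * (s * t), ?_, by push_cast; ring⟩
    exact add_mem (add_mem (mul_mem (intCast_mem O a) (mul_mem hu ht))
      (mul_mem (intCast_mem O b) (mul_mem hs hv))) (mul_mem (natCast_mem O N) (mul_mem hs ht))
  · have hmem {x : K} (hx : x ∈ O) (z : K) : N * x ∈ intMulAdd N O z := ⟨0, x, hx, by simp⟩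
    have hself (z : K) : z ∈ intMulAdd N O z := ⟨1, 0, zero_mem O, by simp⟩
    rintro _ ⟨a, s, hs, rfl⟩
    -- Since uw = 1 + Ny, the element Ns equals u(Nws) − (Ny)(Ns), a combination of products from
    -- the two factors.
    have key : a * (u * v) + N * s = a • (u * v) + (u * (N * (w * s)) - N * y * (N * s)) := by
      rw [zsmul_eq_mul]
      linear_combination (-N * s) * h
    rw [key]
    refine add_mem (Submodule.smul_mem _ _ ?_) (sub_mem ?_ ?_)
    · exact Submodule.mul_mem_mul (hself u) (hself v)
    · exact Submodule.mul_mem_mul (hself u) (hmem (mul_mem hw hs) v)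
    · exact Submodule.mul_mem_mul (hmem hy u) (hmem hs v)

theorem exists_latt_eq_intMulAdd {N : ℕ} [IsFractionRing (intAdd N O) K] {u : K}
    (hu : IsUnitMod N O u) :
    ∃ U : (FractionalIdeal (intAdd N O)⁰ K)ˣ, latt U = intMulAdd N O u := by
  obtain ⟨huO, w, hw, y, hy, h⟩ := id hu
  refine exists_latt_eq (J := intMulAdd N O w) ?_ ?_ ?_
  · rw [← intMulAdd_one, intMulAdd_mul hu (one_mem O), mul_one]
  · rw [← intMulAdd_one, mul_comm, intMulAdd_mul (isUnitMod_one N) hw, one_mul]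
  · rw [intMulAdd_mul hu hw, h, intMulAdd_add _ _ hy, intMulAdd_one]

theorem latt_pow_eq_intMulAdd {N : ℕ} [IsFractionRing (intAdd N O) K] {u : K}
    (hu : IsUnitMod N O u) {U : (FractionalIdeal (intAdd N O)⁰ K)ˣ}
    (hU : latt U = intMulAdd N O u) (k : ℕ) : latt (U ^ k) = intMulAdd N O (u ^ k) := by
  induction k with
  | zero => rw [pow_zero, pow_zero, latt_one, intMulAdd_one]
  | succ k ih => rw [pow_succ, latt_mul, ih, hU, intMulAdd_mul (hu.pow k) hu.1, pow_succ]

/-- As p is nilpotent modulo p^n, a truncated geometric series inverts 1 + px. -/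
theorem isUnitMod_one_add {p : ℕ} {x : K} (hx : x ∈ O) (n : ℕ) :
    IsUnitMod (p ^ n) O (1 + p * x) := by
  refine ⟨add_mem (one_mem O) (mul_mem (natCast_mem O p) hx), ?_⟩
  refine ⟨∑ i ∈ Finset.range n, (-(p * x)) ^ i, sum_mem fun i _ =>
    pow_mem (neg_mem (mul_mem (natCast_mem O p) hx)) i, -(-x) ^ n,
    neg_mem (pow_mem (neg_mem hx) n), ?_⟩
  have := mul_neg_geom_sum (-(p * x)) n
  rw [sub_neg_eq_add] at this
  rw [this, ← mul_neg, mul_pow]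
  push_cast
  ring

theorem exists_one_add_pow_eq {R : Type*} [CommRing R] (x : R) (k : ℕ) :
    ∃ t, (1 + x) ^ k = 1 + k * x + (k.choose 2 : ℕ) * x ^ 2 + x ^ 3 * t := by
  induction k with
  | zero => exact ⟨0, by simp⟩
  | succ k ih =>
    obtain ⟨t, ht⟩ := ih
    refine ⟨(k.choose 2 : ℕ) + t + x * t, ?_⟩
    rw [pow_succ, ht, Nat.choose_succ_succ' k 1, Nat.choose_one_right]
    push_cast
    ring

/-- The quadratic binomial term is divisible by p^{2n+1}, since an odd prime p divides `p.choose 2`,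
and the remaining terms by p^{3n}; both exponents are at least n+2 when n ≥ 1. -/
theorem intMulAdd_one_add_pow {p : ℕ} (hp : p.Prime) (hodd : Odd p) {n : ℕ} (hn : 1 ≤ n) {x : K}
    (hx : x ∈ O) :
    intMulAdd (p ^ (n + 2)) O ((1 + (p ^ n : ℕ) * x) ^ p) =
      intMulAdd (p ^ (n + 2)) O (1 + (p ^ (n + 1) : ℕ) * x) := by
  obtain ⟨m, rfl⟩ := Nat.exists_eq_add_of_le' hn
  obtain ⟨⟨t, htO⟩, ht⟩ := exists_one_add_pow_eq ((p ^ (m + 1) : ℕ) * (⟨x, hx⟩ : O)) p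
  have ht' := congrArg (Subtype.val : O → K) ht
  obtain ⟨c, hc⟩ : p ∣ p.choose 2 := by
    apply hp.dvd_choose_self two_ne_zero
    have := hp.two_le
    have : p ≠ 2 := by
      rintro rfl
      exact absurd hodd (by decide)
    omega
  rw [hc] at ht'
  push_cast at ht'
  have key : (1 + ((p ^ (m + 1) : ℕ) : K) * x) ^ p = 1 + (p ^ (m + 1 + 1) : ℕ) * x +
      ((p ^ (m + 1 + 2) : ℕ) : K) * (p ^ m * (c * x ^ 2) + p ^ (2 * m) * (x ^ 3 * t)) := by
    push_cast
    rw [ht']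
    ring
  rw [key, intMulAdd_add]
  refine add_mem (mul_mem (pow_mem (natCast_mem O p) m) (mul_mem (natCast_mem O c) (pow_mem hx 2)))
    (mul_mem (pow_mem (natCast_mem O p) _) (mul_mem (pow_mem hx 3) htO))

/-- One level lower 2n ≥ n+1 suffices. This shows that the kernel of extension is killed by p. -/
theorem intMulAdd_one_add_pow_eq_one {p n : ℕ} (hn : 1 ≤ n) {x : K} (hx : x ∈ O) :
    intMulAdd (p ^ (n + 1)) O ((1 + (p ^ n : ℕ) * x) ^ p) = intMulAdd (p ^ (n + 1)) O 1 := by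
  obtain ⟨m, rfl⟩ := Nat.exists_eq_add_of_le' hn
  obtain ⟨⟨t, htO⟩, ht⟩ := exists_one_add_pow_eq ((p ^ (m + 1) : ℕ) * (⟨x, hx⟩ : O)) p
  have ht' := congrArg (Subtype.val : O → K) ht
  push_cast at ht'
  have key : (1 + ((p ^ (m + 1) : ℕ) : K) * x) ^ p = 1 + ((p ^ (m + 1 + 1) : ℕ) : K) *
      (x + p ^ m * ((p.choose 2 : ℕ) * x ^ 2 + (p ^ (m + 1) : ℕ) * (x ^ 3 * t))) := by
    push_cast
    rw [ht']
    ring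
  rw [key, intMulAdd_add]
  exact add_mem hx (mul_mem (pow_mem (natCast_mem O p) m) (add_mem (mul_mem (natCast_mem O _)
    (pow_mem hx 2)) (mul_mem (natCast_mem O _) (mul_mem (pow_mem hx 3) htO))))

end IntAdd

/-! ### The kernel of extension, and passing to a smaller order. -/

section Ascent

variable {K : Type*} [Field K] {O : Subalgebra ℤ K}

/-- Elements of O are integral over ℤ, and 1/p is not. -/
theorem natCast_mul_ne_one [CharZero K] [Module.Finite ℤ O] {p : ℕ} (hp : p.Prime) :
    ∀ x ∈ O, (p : K) * x ≠ 1 := by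
  intro x hx h
  have hint : IsIntegral ℤ x := by
    have := (Algebra.IsIntegral.isIntegral (R := ℤ) (⟨x, hx⟩ : O)).map O.val
    exact this
  have hp0 : (p : ℚ) ≠ 0 := by exact_mod_cast hp.ne_zero
  have hx' : x = algebraMap ℚ K (p : ℚ)⁻¹ := by
    rw [map_inv₀, map_natCast]
    exact eq_inv_of_mul_eq_one_right h
  rw [hx', isIntegral_algebraMap_iff (algebraMap ℚ K).injective,
    IsIntegrallyClosed.isIntegral_iff] at hint
  obtain ⟨y, hy⟩ := hint
  have h1 : (p : ℤ) * y = 1 := by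
    have : (p : ℚ) * y = 1 := by
      rw [eq_intCast] at hy
      rw [hy, mul_inv_cancel₀ hp0]
    exact_mod_cast this
  have := Int.eq_one_or_neg_one_of_mul_eq_one h1
  have := hp.two_le
  omega

theorem dvd_of_intCast_eq_mul {p : ℕ} (hp : p.Prime) (hpO : ∀ x ∈ O, (p : K) * x ≠ 1) {j : ℤ}
    {x : K} (hx : x ∈ O) (h : (j : K) = p * x) : (p : ℤ) ∣ j := by
  by_contra hj
  obtain ⟨s, t, hst⟩ := (Nat.prime_iff_prime_int.1 hp).irreducible.coprime_iff_not_dvd.2 hj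
  have hst' : (s : K) * p + t * j = 1 := by simpa using congrArg (Int.cast : ℤ → K) hst
  refine hpO (s + t * x) (add_mem (intCast_mem O s) (mul_mem (intCast_mem O t) hx)) ?_
  linear_combination hst' - t * h

/-- An ideal that becomes trivial in `ℤ + p ^ m O` contains `ℤ u + p ^ (m + 1) O` for some
`u ≡ 1 mod p ^ m O`. -/
theorem exists_intMulAdd_le {p : ℕ} (hp : p.Prime) (hpO : ∀ x ∈ O, (p : K) * x ≠ 1) {m : ℕ}
    (hm : 1 ≤ m) {U : (FractionalIdeal (intAdd (p ^ (m + 1)) O)⁰ K)ˣ}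
    (hU : latt U * Subalgebra.toSubmodule (intAdd (p ^ m) O) =
      Subalgebra.toSubmodule (intAdd (p ^ m) O)) :
    ∃ x ∈ O, intMulAdd (p ^ (m + 1)) O (1 + (p ^ m : ℕ) * x) ≤ latt U := by
  obtain ⟨l, rfl⟩ := Nat.exists_eq_add_of_le' hm
  set B := intAdd (p ^ (l + 1)) O
  have hle : latt U ≤ Subalgebra.toSubmodule B := by
    calc latt U = latt U * 1 := (mul_one _).symm
      _ ≤ latt U * Subalgebra.toSubmodule B := mul_le_mul' le_rfl (one_le_toSubmodule B)
      _ = _ := hU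
  have hpB : Submodule.span ℤ {(p : K)} * Subalgebra.toSubmodule B ≤ latt U := by
    rw [← hU, mul_left_comm]
    nth_rw 2 [← latt_mul_self U]
    exact mul_le_mul' le_rfl (span_mul_intAdd_le p (l + 1))
  have hpmem {y : K} (hy : y ∈ B) : (p : K) * y ∈ latt U :=
    hpB (Submodule.mul_mem_mul (Submodule.mem_span_singleton_self _) hy)
  -- Otherwise U ⊆ pO, and 1 ∈ UB would lie in pO.
  have hex : ∃ a : ℤ, ¬ (p : ℤ) ∣ a ∧ ∃ y ∈ O, (a : K) + (p ^ (l + 1) : ℕ) * y ∈ latt U := by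
    by_contra! h
    have hUO : latt U ≤ Submodule.span ℤ {(p : K)} * Subalgebra.toSubmodule O := by
      intro z hz
      obtain ⟨a, y, hy, rfl⟩ := hle hz
      by_cases ha : (p : ℤ) ∣ a
      · obtain ⟨b, rfl⟩ := ha
        rw [Submodule.mem_span_singleton_mul]
        exact ⟨b + p ^ l * y, show _ ∈ O from add_mem (intCast_mem O b)
          (mul_mem (pow_mem (natCast_mem O p) l) hy), by push_cast; ring⟩
      · exact absurd hz (h a ha y hy)
    have h1 : (1 : K) ∈ latt U * Subalgebra.toSubmodule B := by
      rw [hU]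
      exact one_mem B
    have h2 : (1 : K) ∈ Submodule.span ℤ {(p : K)} * Subalgebra.toSubmodule O := by
      rw [← toSubmodule_mul_self O, ← mul_assoc]
      exact mul_le_mul' hUO (intAdd_le _ : B ≤ O) h1
    obtain ⟨x, hx, h3⟩ := Submodule.mem_span_singleton_mul.1 h2
    exact hpO x hx h3
  obtain ⟨a, ha, y, hy, hay⟩ := hex
  obtain ⟨s, t, hst⟩ := (Nat.prime_iff_prime_int.1 hp).irreducible.coprime_iff_not_dvd.2 ha
  have hst' : (s : K) * p + t * a = 1 := by simpa using congrArg (Int.cast : ℤ → K) hst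
  refine ⟨t * y, mul_mem (intCast_mem O t) hy, ?_⟩
  have hu : 1 + ((p ^ (l + 1) : ℕ) : K) * (t * y) ∈ latt U := by
    have : 1 + ((p ^ (l + 1) : ℕ) : K) * (t * y) =
        p * s + t • ((a : K) + (p ^ (l + 1) : ℕ) * y) := by
      rw [zsmul_eq_mul]
      linear_combination -hst'
    rw [this]
    exact add_mem (hpmem (intCast_mem B s)) (Submodule.smul_mem _ t hay)
  rintro _ ⟨b, z, hz, rfl⟩
  rw [← zsmul_eq_mul]
  refine add_mem (Submodule.smul_mem _ b hu) ?_
  have : ((p ^ (l + 1 + 1) : ℕ) : K) * z = p * ((p ^ (l + 1) : ℕ) * z) := by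
    push_cast
    ring
  rw [this]
  exact hpmem ⟨0, z, hz, by rw [Int.cast_zero, zero_add]⟩

/-- Write L_u for ℤu + p^{m+1} O. The inclusions L_u ⊆ U and L_v ⊆ U⁻¹ are forced to be sharp: L_u
L_v contains the whole order, so U ⊆ U L_u L_v ⊆ U L_u U⁻¹ = L_u. -/
theorem exists_latt_eq_one_add {p : ℕ} (hp : p.Prime) (hpO : ∀ x ∈ O, (p : K) * x ≠ 1) {m : ℕ}
    (hm : 1 ≤ m) {U : (FractionalIdeal (intAdd (p ^ (m + 1)) O)⁰ K)ˣ}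
    (hU : latt U * Subalgebra.toSubmodule (intAdd (p ^ m) O) =
      Subalgebra.toSubmodule (intAdd (p ^ m) O)) :
    ∃ x ∈ O, latt U = intMulAdd (p ^ (m + 1)) O (1 + (p ^ m : ℕ) * x) := by
  have hU' : latt U⁻¹ * Subalgebra.toSubmodule (intAdd (p ^ m) O) =
      Subalgebra.toSubmodule (intAdd (p ^ m) O) := by
    nth_rw 1 [← hU]
    rw [← mul_assoc, mul_comm (latt U⁻¹), latt_mul_inv,
      toSubmodule_mul_of_le (intAdd_pow_succ_le p m)]
  obtain ⟨x, hx, hxU⟩ := exists_intMulAdd_le hp hpO hm hU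
  obtain ⟨y, hy, hyU⟩ := exists_intMulAdd_le hp hpO hm hU'
  refine ⟨x, hx, le_antisymm ?_ hxU⟩
  obtain ⟨l, rfl⟩ := Nat.exists_eq_add_of_le' hm
  set u : K := 1 + (p ^ (l + 1) : ℕ) * x with hu_def
  set v : K := 1 + (p ^ (l + 1) : ℕ) * y with hv_def
  have hu : IsUnitMod (p ^ (l + 1 + 1)) O u := by
    have := isUnitMod_one_add (p := p) (mul_mem (pow_mem (natCast_mem O p) l) hx) (l + 1 + 1)
    convert this using 1
    rw [hu_def]
    push_cast
    ring
  have hv : v ∈ O := add_mem (one_mem O) (mul_mem (natCast_mem O _) hy)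
  have hself (z : K) : z ∈ intMulAdd (p ^ (l + 1 + 1)) O z := ⟨1, 0, zero_mem O, by simp⟩
  have huv : u * v ∈ intAdd (p ^ (l + 1 + 1)) O := by
    have := Submodule.mul_mem_mul (hxU (hself u)) (hyU (hself v))
    rwa [latt_mul_inv] at this
  obtain ⟨k, z, hz, hkz⟩ := huv
  -- Both u and v are 1 modulo pO; thus k is invertible modulo p^{l+2}, which puts 1 in L_{uv}.
  have hk : (p : ℤ) ∣ k - 1 := by
    refine dvd_of_intCast_eq_mul hp hpO (x := p ^ l * (x + y) + p ^ (2 * l + 1) * (x * y) -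
      p ^ (l + 1) * z) ?_ ?_
    · exact sub_mem (add_mem (mul_mem (pow_mem (natCast_mem O p) _) (add_mem hx hy))
        (mul_mem (pow_mem (natCast_mem O p) _) (mul_mem hx hy)))
        (mul_mem (pow_mem (natCast_mem O p) _) hz)
    · rw [hu_def, hv_def] at hkz
      push_cast at hkz ⊢
      linear_combination -hkz
  have hcop : IsCoprime k ((p : ℤ) ^ (l + 1 + 1)) := by
    apply IsCoprime.pow_right
    obtain ⟨c, hc⟩ := hk
    exact ⟨1, -c, by linear_combination hc⟩
  have hone : (1 : K) ∈ intMulAdd (p ^ (l + 1 + 1)) O (u * v) := by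
    rw [hkz, intMulAdd_add _ _ hz]
    obtain ⟨s, t, hst⟩ := hcop
    refine ⟨s, t, intCast_mem O t, ?_⟩
    have := congrArg (Int.cast : ℤ → K) hst
    push_cast at this
    push_cast
    linear_combination -this
  have hle : Subalgebra.toSubmodule (intAdd (p ^ (l + 1 + 1)) O) ≤
      intMulAdd (p ^ (l + 1 + 1)) O u * intMulAdd (p ^ (l + 1 + 1)) O v := by
    rw [intMulAdd_mul hu hv]
    rintro _ ⟨a, w, hw, rfl⟩
    refine add_mem ?_ ⟨0, w, hw, by simp⟩
    have := Submodule.smul_mem _ a hone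
    rwa [zsmul_eq_mul, mul_one] at this
  calc latt U = latt U * Subalgebra.toSubmodule (intAdd (p ^ (l + 1 + 1)) O) :=
        (latt_mul_self U).symm
    _ ≤ latt U * (intMulAdd (p ^ (l + 1 + 1)) O u * latt U⁻¹) :=
        mul_le_mul' le_rfl (hle.trans (mul_le_mul' le_rfl hyU))
    _ = intMulAdd (p ^ (l + 1 + 1)) O u := by
        rw [mul_left_comm, latt_mul_inv, ← intMulAdd_one, intMulAdd_mul hu (one_mem O), mul_one]

theorem idealSubgroup_intAdd_succ_eq_top {p : ℕ} (hp : p.Prime) (hodd : Odd p)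
    (hpO : ∀ x ∈ O, (p : K) * x ≠ 1) {n : ℕ} (hn : 1 ≤ n)
    [IsFractionRing (intAdd (p ^ (n + 1)) O) K] [IsFractionRing (intAdd (p ^ (n + 2)) O) K]
    {P : Set ℕ} (hP : ∀ q ∈ P, p.Coprime q)
    (h : idealSubgroup (intAdd (p ^ (n + 1)) O) P = ⊤) :
    idealSubgroup (intAdd (p ^ (n + 2)) O) P = ⊤ := by
  have hle : intAdd (p ^ (n + 2)) O ≤ intAdd (p ^ (n + 1)) O := intAdd_pow_succ_le p (n + 1)
  obtain ⟨E, hE⟩ := exists_extend hle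
  have hmap := map_idealSubgroup hle (span_mul_intAdd_le p (n + 1)) hP hE
  have hker {U} (hU : E U = 1) :
      ∃ x ∈ O, latt U = intMulAdd (p ^ (n + 2)) O (1 + (p ^ (n + 1) : ℕ) * x) :=
    exists_latt_eq_one_add hp hpO (Nat.le_add_left 1 n) (by rw [← hE, hU, latt_one])
  have hunit {x : K} (hx : x ∈ O) {j : ℕ} (hj : 1 ≤ j) :
      IsUnitMod (p ^ (n + 2)) O (1 + (p ^ j : ℕ) * x) := by
    obtain ⟨l, rfl⟩ := Nat.exists_eq_add_of_le' hj
    have := isUnitMod_one_add (p := p) (mul_mem (pow_mem (natCast_mem O p) l) hx) (n + 2)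
    convert this using 1
    push_cast
    ring
  have hdec (U) : ∃ W ∈ idealSubgroup (intAdd (p ^ (n + 2)) O) P, E (W⁻¹ * U) = 1 := by
    have : E U ∈ (idealSubgroup (intAdd (p ^ (n + 2)) O) P).map E := by
      rw [hmap, h]
      trivial
    obtain ⟨W, hW, hWU⟩ := this
    exact ⟨W, hW, by rw [map_mul, map_inv, hWU, inv_mul_cancel]⟩
  have hexp {U} (hU : E U = 1) : U ^ p = 1 := by
    obtain ⟨x, hx, hUx⟩ := hker hU
    apply latt_injective
    rw [latt_pow_eq_intMulAdd (hunit hx (Nat.le_add_left 1 n)) hUx,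
      intMulAdd_one_add_pow_eq_one (Nat.le_add_left 1 n) hx, intMulAdd_one, latt_one]
  rw [eq_top_iff]
  rintro U -
  obtain ⟨W, hW, hWU⟩ := hdec U
  suffices W⁻¹ * U ∈ idealSubgroup (intAdd (p ^ (n + 2)) O) P by
    simpa only [mul_inv_cancel_left] using mul_mem hW this
  obtain ⟨x, hx, hUx⟩ := hker hWU
  -- The p-th root is taken with 1 + p^n x, one level below the kernel element 1 + p^{n+1} x.
  obtain ⟨Y, hY⟩ := exists_latt_eq_intMulAdd (hunit hx hn)
  have hYp : W⁻¹ * U = Y ^ p := by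
    apply latt_injective
    rw [hUx, latt_pow_eq_intMulAdd (hunit hx hn) hY, intMulAdd_one_add_pow hp hodd hn hx]
  -- Z⁻¹Y lies in the kernel, hence is killed by p, so Y^p = Z^p.
  obtain ⟨Z, hZ, hZY⟩ := hdec Y
  have := hexp hZY
  rw [mul_pow, inv_pow, inv_mul_eq_one] at this
  rw [hYp, ← this]
  exact pow_mem hZ p

end Ascent

/-- O spans K over ℚ, so each z has a nonzero multiple mz in O, and Nmz then lies in NO. -/
theorem isFractionRing_intAdd {K : Type*} [Field K] [NumberField K] (O : Subalgebra ℤ K)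
    [IsOrder O] {N : ℕ} (hN : N ≠ 0) : IsFractionRing (intAdd N O) K := by
  have key (x : K) : ∃ m : ℕ, m ≠ 0 ∧ (m : K) * x ∈ O := by
    have hx : x ∈ Submodule.span ℚ (O : Set K) := IsOrder.span_eq_top (O := O) ▸ trivial
    induction hx using Submodule.span_induction with
    | mem x hx => exact ⟨1, one_ne_zero, by simpa using hx⟩
    | zero => exact ⟨1, one_ne_zero, by simp⟩
    | add x y _ _ hx hy =>
      obtain ⟨m, hm, hmx⟩ := hx
      obtain ⟨k, hk, hky⟩ := hy
      refine ⟨m * k, mul_ne_zero hm hk, ?_⟩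
      have := add_mem (mul_mem (natCast_mem O k) hmx) (mul_mem (natCast_mem O m) hky)
      convert this using 1
      push_cast
      ring
    | smul r x _ hx =>
      obtain ⟨m, hm, hmx⟩ := hx
      refine ⟨r.den * m, mul_ne_zero r.den_nz hm, ?_⟩
      have := mul_mem (intCast_mem O r.num) hmx
      convert this using 1
      have hr : (r : K) * r.den = r.num := by exact_mod_cast Rat.mul_den_eq_num r
      rw [Rat.smul_def, ← hr]
      push_cast
      ring
  refine IsFractionRing.of_field (intAdd N O) K fun z => ?_
  obtain ⟨m, hm, hmz⟩ := key z
  have hNm : ((N * m : ℕ) : K) ≠ 0 := by exact_mod_cast mul_ne_zero hN hm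
  refine ⟨⟨N * (m * z), 0, m * z, hmz, by simp⟩, (N * m : ℕ), ?_⟩
  rw [map_natCast, eq_div_iff hNm]
  change _ = (N : K) * (m * z)
  push_cast
  ring

end QuadOrder

theorem mainTheorem4 {K : Type*} [Field K] [NumberField K]
    (hK : Module.finrank ℚ K = 2) (hd : NumberField.discr K < -4)
    (O : Subalgebra ℤ K) [QuadOrder.IsOrder O]
    (p : ℕ) (hp : p.Prime) (hodd : Odd p) (hpO : ¬ (p : ℤ) ∣ QuadOrder.disc O)
    (P : Set ℕ) (hP : ∀ q ∈ P, q.Prime ∧ ¬ q ∣ p * QuadOrder.index O)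
    (h2 : Subgroup.closure (QuadOrder.normClasses (QuadOrder.intAdd (p ^ 2) O) P) = ⊤) (n : ℕ) :
    Subgroup.closure (QuadOrder.normClasses (QuadOrder.intAdd (p ^ n) O) P) = ⊤ := by
  have hfrac (k : ℕ) : IsFractionRing (QuadOrder.intAdd (p ^ k) O) K :=
    QuadOrder.isFractionRing_intAdd O (pow_ne_zero k hp.ne_zero)
  have hfin (k : ℕ) : Module.Finite ℤ (QuadOrder.intAdd (p ^ k) O) :=
    Module.Finite.of_injective (Subalgebra.inclusion (QuadOrder.intAdd_le (p ^ k))).toLinearMap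
      (Subalgebra.inclusion_injective (QuadOrder.intAdd_le (p ^ k)))
  have hpunit : ∀ x ∈ O, (p : K) * x ≠ 1 := QuadOrder.natCast_mul_ne_one hp
  have hcop : ∀ q ∈ P, p.Coprime q := fun q hq =>
    (Nat.coprime_primes hp (hP q hq).1).2 fun h => (hP q hq).2 (h ▸ dvd_mul_right _ _)
  rw [QuadOrder.closure_normClasses_eq_top_iff (K := K)] at h2 ⊢
  have hdown (k : ℕ) (h : QuadOrder.idealSubgroup (QuadOrder.intAdd (p ^ (k + 1)) O) P = ⊤) :
      QuadOrder.idealSubgroup (QuadOrder.intAdd (p ^ k) O) P = ⊤ :=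
    QuadOrder.idealSubgroup_eq_top_of_le (QuadOrder.intAdd_pow_succ_le p k) hp.ne_zero
      (fun x hx => hpunit x (QuadOrder.intAdd_le _ hx)) (QuadOrder.span_mul_intAdd_le p k) hcop h
  have hup (k : ℕ) : QuadOrder.idealSubgroup (QuadOrder.intAdd (p ^ (k + 2)) O) P = ⊤ := by
    induction k with
    | zero => exact h2
    | succ k ih =>
      exact QuadOrder.idealSubgroup_intAdd_succ_eq_top hp hodd hpunit (Nat.le_add_left 1 k) hcop ih
  -- Climbing to level n+2 and descending twice covers n = 0 and n = 1 without a case split.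
  exact hdown n (hdown (n + 1) (hup n))
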